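/- Let $G$ be a connected four-dimensional Lie group with Lie algebra $(\mathfrak g,[\cdot,\cdot])$, let $\mathfrak q\subset\mathfrak g$ be a three-dimensional subspace that generates $\mathfrak g$, and let $(\cdot,\cdot)_1$ be a scalar product on $\mathfrak q$, with norm $F(u)=\sqrt{(u,u)_1}$ and unit ball $U=\{u\in\mathfrak q: F(u)\le 1\}$; it defines a left-invariant sub-Riemannian metric $d$ on $G$. Say that a locally absolutely continuous curve $g:\mathbb R\to G$ is an extremal of $(G,d)$ if there are a measurable control $u:\mathbb R\to U$ with $F(u(t))=1$ and $\dot g(t)=dl_{g(t)}(u(t))$ for almost all $t$ (where $l_g(h)=gh$), a nowhere zero locally absolutely continuous covector function $\psi(t)\in T^*_{g(t)}G$ and a constant $M\ge 0$ satisfying the Pontryagin maximum principle: for almost all $t$ the curve $(g(t),\psi(t))$ in $T^*G$ satisfies the Hamiltonian (adjoint) equations of $\mathcal H(x,p;u(t))=p(dl_{x}(u(t)))$, and $$\psi(t)(dl_{g(t)}(u(t)))=\max_{v\in U}\psi(t)(dl_{g(t)}(v))=M .$$ The extremal is abnormal if such $u,\psi$ exist with $M=0$, normal if they exist with $M>0$,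 and nonstrongly abnormal if it is both abnormal and normal (for different $\psi$). Let $e_2\neq 0$ be a vector of $\mathfrak q$ with $[e_2,\mathfrak q]\subset\mathfrak q$ (such a vector exists and is unique up to a factor), and let $(\tilde e_1,\tilde e_2,\tilde e_3)$ be a basis of $\mathfrak q$, orthonormal for $(\cdot,\cdot)_1$, with $\tilde e_2\parallel e_2$. Then for each $s\in\{1,-1\}$ the curve $$g(t)=\exp\left(\frac{s\,t\,e_2}{F(s e_2)}\right),\qquad t\in\mathbb R,$$ is an abnormal extremal of $(G,d)$, and it is nonstrongly abnormal if and only if $[e_2,\mathfrak q]\subset\operatorname{span}(\tilde e_1,\tilde e_3)$. -/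

import Mathlib

open scoped Manifold ContDiff

/-- Over `ℝ`, smooth Lie groups have the regularity required by Mathlib's Lie algebra structure on
`GroupLieAlgebra I G` (the tangent space at `1`, with the bracket of left-invariant fields). -/
instance lieGroupMinSmoothness {E : Type*} [NormedAddCommGroup E] [NormedSpace ℝ E]
    {H : Type*} [TopologicalSpace H] {I : ModelWithCorners ℝ E H}
    {G : Type*} [TopologicalSpace G] [ChartedSpace H G] [Group G] [LieGroup I ∞ G] :
    LieGroup I (minSmoothness ℝ 3) G :=
  LieGroup.of_le (n := ∞) (by simp only [minSmoothness_of_isRCLikeNormedField]; exact ENat.LEInfty.out)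

/-- Left-invariant vector fields on a Lie group are complete: for each `X` in the Lie algebra there
is an integral curve through `1` that is defined on the whole line. -/
theorem exists_expCurve {E : Type*} [NormedAddCommGroup E] [NormedSpace ℝ E] [CompleteSpace E]
    {H : Type*} [TopologicalSpace H] {I : ModelWithCorners ℝ E H}
    {G : Type*} [TopologicalSpace G] [ChartedSpace H G] [Group G] [LieGroup I ∞ G]
    [BoundarylessManifold I G] (X : GroupLieAlgebra I G) :
    ∃ γ : ℝ → G, γ 0 = 1 ∧ IsMIntegralCurve (I := I) γ (mulInvariantVectorField X) := by
  have : IsTopologicalGroup G := topologicalGroup_of_lieGroup I ∞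
  have : T1Space G := I.t1Space G
  have : T2Space G := inferInstance
  have hv0 := contMDiff_mulInvariantVectorField X
  have hv : ContMDiff I I.tangent 1
      (fun x ↦ (⟨x, mulInvariantVectorField X x⟩ : TangentBundle I G)) :=
    hv0.of_le (by simp only [minSmoothness_of_isRCLikeNormedField]; exact mod_cast (by norm_num))
  obtain ⟨γ, h0, hγ⟩ := exists_isMIntegralCurveAt_of_contMDiffAt_boundaryless (t₀ := 0)
    (hv.contMDiffAt (x := (1 : G)))
  obtain ⟨ε, hε, hγ⟩ := isMIntegralCurveAt_iff'.1 hγ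
  refine exists_isMIntegralCurve_of_isMIntegralCurveOn hv hε (fun x ↦ ?_) 1
  refine ⟨fun t ↦ x * γ t, by simp [h0], fun t ht ↦ ?_⟩
  have ht' : t ∈ Metric.ball (0 : ℝ) ε := by
    rw [Real.ball_eq_Ioo]; simpa using ht
  have h1 := hγ t ht'
  have hm : ∀ y : G, MDifferentiableAt I I (fun b : G ↦ x * b) y := fun y ↦
    (contMDiff_mul_left (I := I) (n := ∞)).contMDiffAt.mdifferentiableAt (by simp)
  have hm' : ∀ h : G, MDifferentiableAt I I (fun b : G ↦ h * b) 1 := fun h ↦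
    (contMDiff_mul_left (I := I) (n := ∞)).contMDiffAt.mdifferentiableAt (by simp)
  have key : mulInvariantVectorField X (x * γ t) =
      mfderiv I I (fun b : G ↦ x * b) (γ t) (mulInvariantVectorField X (γ t)) := by
    have hc : (fun b : G ↦ x * γ t * b) = (fun b : G ↦ x * b) ∘ (fun b : G ↦ γ t * b) := by
      ext b; simp [mul_assoc]
    have h2 := mfderiv_comp_apply_of_eq (I := I) (I' := I) (I'' := I) (x := (1 : G)) (y := γ t)
      (g := fun b : G ↦ x * b) (f := fun b : G ↦ γ t * b) (hm _) (hm' (γ t)) (mul_one _) X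
    rw [← hc] at h2
    exact h2
  have h3 := (hm (γ t)).hasMFDerivAt.comp_hasMFDerivWithinAt t h1
  have hset : Metric.ball (0 : ℝ) ε = Set.Ioo (-ε) ε := by rw [Real.ball_eq_Ioo]; simp
  rw [hset] at h3
  refine HasMFDerivWithinAt.congr_mfderiv h3 ?_
  ext
  simp only [key]
  exact (mfderiv I I (fun b : G ↦ x * b) (γ t)).map_smul (1 : ℝ) _

/-- The exponential map of a Lie group: `lieExp X = γ 1`, where `γ` is the integral curve through
`1` of the left-invariant vector field with value `X` at `1`. -/
noncomputable def lieExp {E : Type*} [NormedAddCommGroup E] [NormedSpace ℝ E] [CompleteSpace E]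
    {H : Type*} [TopologicalSpace H] {I : ModelWithCorners ℝ E H}
    {G : Type*} [TopologicalSpace G] [ChartedSpace H G] [Group G] [LieGroup I ∞ G]
    [BoundarylessManifold I G] (X : GroupLieAlgebra I G) : G :=
  Classical.choose (exists_expCurve X) 1

/-- The Pontryagin maximum principle for the time-optimal problem of the left-invariant control
system `g' = dl_g (u)`, `u ∈ U = {u ∈ q | F u ≤ 1}`, along a curve `g` defined on the whole line,
with control `u`, covector function `ψ t ∈ T*_{g t} G` and maximum `M`.

The adjoint equation is Hamilton's equation for `H(x, p) = p (dl_x (u t))` in its coordinate-free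
form `(ψ (W ∘ g))' = ψ ([dl (u t), W] ∘ g)` for every smooth vector field `W`; in local
coordinates it reads `p_i' = - ∂H/∂x_i`. As the domain is the whole line, it is automatically
maximal. -/
structure SatisfiesPMP {E : Type*} [NormedAddCommGroup E] [NormedSpace ℝ E]
    {H : Type*} [TopologicalSpace H] {I : ModelWithCorners ℝ E H}
    {G : Type*} [TopologicalSpace G] [ChartedSpace H G] [Group G] [LieGroup I ∞ G]
    (q : Submodule ℝ (GroupLieAlgebra I G)) (F : q → ℝ)
    (g : ℝ → G) (u : ℝ → q) (ψ : (t : ℝ) → TangentSpace I (g t) →L[ℝ] ℝ) (M : ℝ) : Prop where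
  /-- the trajectory is continuous ... -/
  continuous_curve : Continuous g
  /-- ... and locally absolutely continuous -/
  absolutelyContinuous_curve : ∀ f : G → ℝ, ContMDiff I 𝓘(ℝ, ℝ) ∞ f →
    ∀ a b : ℝ, AbsolutelyContinuousOnInterval (fun t ↦ f (g t)) a b
  /-- the control is measurable -/
  measurable_control : ∀ l : q →ₗ[ℝ] ℝ, Measurable fun t ↦ l (u t)
  /-- the control takes its values in the unit ball -/
  control_mem : ∀ t, F (u t) ≤ 1
  /-- the curve is parametrized by arclength -/
  arclength : ∀ᵐ t, F (u t) = 1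
  /-- the control system `g' = dl_g (u)` -/
  deriv_curve : ∀ᵐ t, HasMFDerivAt 𝓘(ℝ, ℝ) I g t
    ((1 : ℝ →L[ℝ] ℝ).smulRight (mulInvariantVectorField (u t : GroupLieAlgebra I G) (g t)))
  /-- the covector function vanishes nowhere -/
  ne_zero : ∀ t, ψ t ≠ 0
  /-- the covector function is locally absolutely continuous -/
  absolutelyContinuous_covector : ∀ W : (x : G) → TangentSpace I x,
    ContMDiff I I.tangent ∞ (fun x ↦ (⟨x, W x⟩ : TangentBundle I G)) →
    ∀ a b : ℝ, AbsolutelyContinuousOnInterval (fun t ↦ ψ t (W (g t))) a b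
  /-- the adjoint equation -/
  adjoint : ∀ W : (x : G) → TangentSpace I x,
    ContMDiff I I.tangent ∞ (fun x ↦ (⟨x, W x⟩ : TangentBundle I G)) →
    ∀ᵐ t, HasDerivAt (fun τ ↦ ψ τ (W (g τ)))
      (ψ t (VectorField.mlieBracket I
        (mulInvariantVectorField (u t : GroupLieAlgebra I G)) W (g t))) t
  /-- the control maximizes the Hamiltonian over the unit ball -/
  maximum : ∀ᵐ t, ∀ v : q, F v ≤ 1 →
    ψ t (mulInvariantVectorField (v : GroupLieAlgebra I G) (g t)) ≤
      ψ t (mulInvariantVectorField (u t : GroupLieAlgebra I G) (g t))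
  /-- the maximum is constantly equal to `M` -/
  maximum_eq : ∀ᵐ t, ψ t (mulInvariantVectorField (u t : GroupLieAlgebra I G) (g t)) = M
  /-- the maximum is nonnegative -/
  maximum_nonneg : 0 ≤ M

/-- A curve `g : ℝ → G` is an abnormal extremal if it satisfies the maximum principle with
`M = 0` for some control and covector function. -/
def IsAbnormalExtremal {E : Type*} [NormedAddCommGroup E] [NormedSpace ℝ E]
    {H : Type*} [TopologicalSpace H] {I : ModelWithCorners ℝ E H}
    {G : Type*} [TopologicalSpace G] [ChartedSpace H G] [Group G] [LieGroup I ∞ G]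
    (q : Submodule ℝ (GroupLieAlgebra I G)) (F : q → ℝ) (g : ℝ → G) : Prop :=
  ∃ (u : ℝ → q) (ψ : (t : ℝ) → TangentSpace I (g t) →L[ℝ] ℝ), SatisfiesPMP q F g u ψ 0

/-- A curve `g : ℝ → G` is a normal extremal if it satisfies the maximum principle with some
`M > 0` for some control and covector function. -/
def IsNormalExtremal {E : Type*} [NormedAddCommGroup E] [NormedSpace ℝ E]
    {H : Type*} [TopologicalSpace H] {I : ModelWithCorners ℝ E H}
    {G : Type*} [TopologicalSpace G] [ChartedSpace H G] [Group G] [LieGroup I ∞ G]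
    (q : Submodule ℝ (GroupLieAlgebra I G)) (F : q → ℝ) (g : ℝ → G) : Prop :=
  ∃ (u : ℝ → q) (ψ : (t : ℝ) → TangentSpace I (g t) →L[ℝ] ℝ) (M : ℝ),
    0 < M ∧ SatisfiesPMP q F g u ψ M

/-- An extremal is nonstrongly abnormal if it is both abnormal and normal (with respect to
different covector functions). -/
def IsNonstronglyAbnormal {E : Type*} [NormedAddCommGroup E] [NormedSpace ℝ E]
    {H : Type*} [TopologicalSpace H] {I : ModelWithCorners ℝ E H}
    {G : Type*} [TopologicalSpace G] [ChartedSpace H G] [Group G] [LieGroup I ∞ G]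
    (q : Submodule ℝ (GroupLieAlgebra I G)) (F : q → ℝ) (g : ℝ → G) : Prop :=
  IsAbnormalExtremal q F g ∧ IsNormalExtremal q F g

/-- The norm `u ↦ √(u, u)` of a scalar product. -/
noncomputable def scalarProductNorm {V : Type*} [AddCommGroup V] [Module ℝ V]
    (B : InnerProductSpace.Core ℝ V) (v : V) : ℝ :=
  √(B.inner v v)

/-! Put `X = s e₂ / F(s e₂)`, a unit vector of `q` whose one-parameter subgroup is `g`. Left
translation turns a covector function along `g` into a curve `p` in the dual of the Lie algebra, and
the adjoint equation with constant control `X` becomes `p' = p ∘ ad X`, solved by `p₀ ∘ exp (t ad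
X)`. Since `ad X` preserves `q`, a functional `p₀` that vanishes on `[X, q]` stays constant on `q`,
so the maximum condition need only be checked for `p₀` (`exists_dual_flow`,
`exists_satisfiesPMP_of_dual`).

Abnormality follows by taking `p₀ ≠ 0` that kills `q`. For normality, extend `(X, ·)` from `q`:
Cauchy–Schwarz gives the maximum condition, and vanishing on `[X, q]` says exactly that `[e₂, q]` is
orthogonal to `e₂`. Conversely, maximality with `M > 0` forces a normal covector to equal `M (X, ·)`
on `q` (`eq_mul_inner_of_forall_le`). It is therefore constant there, and the adjoint equation gives
`M (X, [X, v]) = 0` (`SatisfiesPMP.inner_lie_eq_zero`). -/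

/-! ### Left-invariant fields and the left trivialization of the tangent bundle -/

section LeftInvariant

open Bundle VectorField

variable {E : Type*} [NormedAddCommGroup E] [NormedSpace ℝ E]
  {H : Type*} [TopologicalSpace H] {I : ModelWithCorners ℝ E H}
  {G : Type*} [TopologicalSpace G] [ChartedSpace H G] [Group G] [LieGroup I ∞ G]

/-- Left-invariant vector fields on a smooth Lie group are smooth. -/
theorem contMDiff_infty_mulInvariantVectorField (v : GroupLieAlgebra I G) :
    ContMDiff I I.tangent ∞
      (fun x ↦ (⟨x, mulInvariantVectorField v x⟩ : TangentBundle I G)) := by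
  -- The field is the derivative of multiplication at `(g, 1)` applied to `(0, v)`.
  let F₁ : G → TangentBundle I G × TangentBundle I G :=
    fun g ↦ (TotalSpace.mk' E g 0, TotalSpace.mk' E 1 v)
  have S₁ : ContMDiff I (I.tangent.prod I.tangent) ∞ F₁ :=
    (contMDiff_zeroSection ℝ (TangentSpace I : G → Type _)).prodMk contMDiff_const
  have S₃ : ContMDiff (I.prod I).tangent I.tangent ∞
      (tangentMap (I.prod I) I (fun p : G × G ↦ p.1 * p.2)) :=
    (contMDiff_mul I ∞).contMDiff_tangentMap (by simp)
  have S := (S₃.comp contMDiff_equivTangentBundleProd_symm).comp S₁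
  have hS : (fun x ↦ (⟨x, mulInvariantVectorField v x⟩ : TangentBundle I G)) =
      (tangentMap (I.prod I) I (fun p : G × G ↦ p.1 * p.2) ∘
        (equivTangentBundleProd I G I G).symm) ∘ F₁ := by
    funext g
    have hmul : MDifferentiableAt (I.prod I) I (fun p : G × G ↦ p.1 * p.2) (g, 1) :=
      (contMDiff_mul I ∞).mdifferentiable (by simp) _
    have h := mfderiv_prod_eq_add_apply hmul (v := (show E × E from ((0 : E), v)))
    apply TotalSpace.ext (mul_one g).symm
    refine heq_of_eq (Eq.trans ?_ h.symm)
    exact ((congrArg (· + _) (map_zero _)).trans (zero_add _)).symm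
  rw [hS]
  exact S

/-- Left translation of tangent vectors to the identity. -/
noncomputable def leftTrivialization (x : G) : TangentSpace I x →L[ℝ] GroupLieAlgebra I G :=
  (show TangentSpace I x →L[ℝ] E from mfderiv I I (fun y : G ↦ x⁻¹ * y) x)

theorem mulInvariantVectorField_leftTrivialization (x : G) (v : TangentSpace I x) :
    mulInvariantVectorField (leftTrivialization x v) x = v := by
  have hm : ∀ a b : G, MDifferentiableAt I I (fun y : G ↦ a * y) b := fun a b ↦
    (contMDiff_mul_left (I := I) (n := ∞)).contMDiffAt.mdifferentiableAt (by simp)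
  have h := mfderiv_comp_apply_of_eq (I := I) (I' := I) (I'' := I) (x := x) (y := (1 : G))
    (g := fun y : G ↦ x * y) (f := fun y : G ↦ x⁻¹ * y) (hm _ _) (hm _ _) (inv_mul_cancel x) v
  have hid : (fun y : G ↦ x * y) ∘ (fun y : G ↦ x⁻¹ * y) = id := by ext y; simp
  rw [hid, mfderiv_id] at h
  exact h.symm

theorem leftTrivialization_mulInvariantVectorField (x : G) (v : GroupLieAlgebra I G) :
    leftTrivialization x (mulInvariantVectorField v x) = v := by
  have hm : ∀ a b : G, MDifferentiableAt I I (fun y : G ↦ a * y) b := fun a b ↦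
    (contMDiff_mul_left (I := I) (n := ∞)).contMDiffAt.mdifferentiableAt (by simp)
  have h := mfderiv_comp_apply_of_eq (I := I) (I' := I) (I'' := I) (x := (1 : G)) (y := x)
    (g := fun y : G ↦ x⁻¹ * y) (f := fun y : G ↦ x * y) (hm _ _) (hm _ _) (mul_one x) v
  have hid : (fun y : G ↦ x⁻¹ * y) ∘ (fun y : G ↦ x * y) = id := by ext y; simp
  rw [hid, mfderiv_id] at h
  exact h.symm

/-- The trivialized vector is the tangent map of multiplication at `(x⁻¹, x)` applied to `(0, W x)`.
This makes the coefficients of `W` in a left-invariant frame smooth. -/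
theorem contMDiff_leftTrivialization {W : (x : G) → TangentSpace I x}
    (hW : ContMDiff I I.tangent ∞ (fun x ↦ (⟨x, W x⟩ : TangentBundle I G))) :
    ContMDiff I 𝓘(ℝ, E) ∞ (fun x ↦ (show E from leftTrivialization x (W x))) := by
  let F₁ : G → TangentBundle I G × TangentBundle I G :=
    fun g ↦ (TotalSpace.mk' E g⁻¹ 0, TotalSpace.mk' E g (W g))
  have S₁ : ContMDiff I (I.tangent.prod I.tangent) ∞ F₁ :=
    ((contMDiff_zeroSection ℝ (TangentSpace I : G → Type _)).comp (contMDiff_inv I ∞)).prodMk hW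
  have S₃ : ContMDiff (I.prod I).tangent I.tangent ∞
      (tangentMap (I.prod I) I (fun p : G × G ↦ p.1 * p.2)) :=
    (contMDiff_mul I ∞).contMDiff_tangentMap (by simp)
  have S := (S₃.comp contMDiff_equivTangentBundleProd_symm).comp S₁
  have hS : (fun x ↦ (⟨1, leftTrivialization x (W x)⟩ : TangentBundle I G)) =
      (tangentMap (I.prod I) I (fun p : G × G ↦ p.1 * p.2) ∘
        (equivTangentBundleProd I G I G).symm) ∘ F₁ := by
    funext g
    have hmul : MDifferentiableAt (I.prod I) I (fun p : G × G ↦ p.1 * p.2) (g⁻¹, g) :=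
      (contMDiff_mul I ∞).mdifferentiable (by simp) _
    have h := mfderiv_prod_eq_add_apply hmul (v := (show E × E from ((0 : E), W g)))
    apply TotalSpace.ext (inv_mul_cancel g).symm
    refine heq_of_eq (Eq.trans ?_ h.symm)
    exact ((congrArg (· + _) (map_zero _)).trans (zero_add _)).symm
  rw [← hS] at S
  intro x
  have h := (contMDiffAt_totalSpace.1 (S x)).2
  refine h.congr_of_eventuallyEq (Filter.Eventually.of_forall fun y ↦ ?_)
  -- All values lie over the base point `1`, where the fibre coordinate in the chart at `1` is the
  -- vector itself.
  exact ((tangentBundleCore I G).coordChange_self (achart H (1 : G)) 1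
    (mem_chart_source H (1 : G)) _).symm

end LeftInvariant

/-! ### Brackets of combinations of fields, integral curves and one-parameter subgroups -/

section Curves

open Bundle VectorField

variable {E : Type*} [NormedAddCommGroup E] [NormedSpace ℝ E]
  {H : Type*} [TopologicalSpace H] {I : ModelWithCorners ℝ E H}

/-- The product rule for the Lie bracket with a linear combination of vector fields. -/
theorem mlieBracket_finset_sum_smul {M : Type*} [TopologicalSpace M] [ChartedSpace H M]
    [IsManifold I 2 M] [CompleteSpace E] {ι : Type*} (s : Finset ι) (V : (x : M) → TangentSpace I x)
    (f : ι → M → ℝ) (W : ι → (x : M) → TangentSpace I x) (x : M)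
    (hf : ∀ i, MDifferentiable I 𝓘(ℝ, ℝ) (f i))
    (hW : ∀ i, MDifferentiable I I.tangent (fun x ↦ (⟨x, W i x⟩ : TangentBundle I M))) :
    mlieBracket I V (∑ i ∈ s, f i • W i) x =
      ∑ i ∈ s, (mvfderiv I (f i) x (V x) • W i x + f i x • mlieBracket I V (W i) x) := by
  classical
  have hfW : ∀ i, MDifferentiable I I.tangent
      (fun x ↦ (⟨x, (f i • W i) x⟩ : TangentBundle I M)) := fun i x ↦
    (hf i x).smul_section (hW i x)
  induction s using Finset.induction_on with
  | empty =>
    simp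
  | insert a s ha ih =>
    have hs : MDifferentiableAt I I.tangent
        (fun x ↦ (⟨x, (∑ i ∈ s, f i • W i) x⟩ : TangentBundle I M)) x := by
      have := MDifferentiableAt.sum_section (s := s) (fun i _ ↦ hfW i x)
      simpa using this
    rw [Finset.sum_insert ha, Finset.sum_insert ha, mlieBracket_add_right (hfW a x) hs, ih,
      mlieBracket_smul_right (hf a x) (hW a x)]

theorem HasMFDerivAt.hasDerivAt_comp_curve {M : Type*} [TopologicalSpace M] [ChartedSpace H M]
    {g : ℝ → M} {t : ℝ} {v : TangentSpace I (g t)} {f : M → ℝ}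
    (hg : HasMFDerivAt 𝓘(ℝ, ℝ) I g t ((1 : ℝ →L[ℝ] ℝ).smulRight v))
    (hf : MDifferentiableAt I 𝓘(ℝ, ℝ) f (g t)) :
    HasDerivAt (fun τ ↦ f (g τ)) (mvfderiv I f (g t) v) t := by
  have h : HasFDerivAt (fun τ ↦ f (g τ)) (show ℝ →L[ℝ] ℝ from
    (mfderiv I 𝓘(ℝ, ℝ) f (g t)).comp ((1 : ℝ →L[ℝ] ℝ).smulRight v)) t :=
    (hf.hasMFDerivAt.comp t hg).hasFDerivAt
  refine h.hasDerivAt.congr_deriv ?_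
  exact congrArg (mfderiv I 𝓘(ℝ, ℝ) f (g t)) (one_smul ℝ v)

theorem absolutelyContinuousOnInterval_of_hasDerivAt {f f' : ℝ → ℝ}
    (hf : ∀ t, HasDerivAt f (f' t) t) (hf' : Continuous f') (a b : ℝ) :
    AbsolutelyContinuousOnInterval f a b := by
  have : ContDiff ℝ 1 f := by
    rw [contDiff_one_iff_deriv]
    refine ⟨fun t ↦ (hf t).differentiableAt, ?_⟩
    rwa [show deriv f = f' from funext fun t ↦ (hf t).deriv]
  exact this.contDiffOn.absolutelyContinuousOnInterval

theorem IsMIntegralCurve.absolutelyContinuousOnInterval_comp {M : Type*} [TopologicalSpace M]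
    [ChartedSpace H M] [IsManifold I 1 M] {g : ℝ → M} {V : (x : M) → TangentSpace I x}
    (hg : IsMIntegralCurve (I := I) g V)
    (hV : Continuous (fun x ↦ (⟨x, V x⟩ : TangentBundle I M)))
    {f : M → ℝ} (hf : ContMDiff I 𝓘(ℝ, ℝ) 1 f) (a b : ℝ) :
    AbsolutelyContinuousOnInterval (fun t ↦ f (g t)) a b := by
  refine absolutelyContinuousOnInterval_of_hasDerivAt
    (fun t ↦ (hg t).hasDerivAt_comp_curve (hf.mdifferentiable (by simp) _)) ?_ a b
  -- The derivative of `f ∘ g` is the fibre part of the tangent map of `f` along `V ∘ g`, hence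
  -- continuous.
  have h := (hf.continuous_tangentMap (by simp)).comp (hV.comp hg.continuous)
  exact (contMDiff_snd_tangentBundle_modelSpace ℝ 𝓘(ℝ, ℝ) (n := 0)).continuous.comp h

variable {G : Type*} [TopologicalSpace G] [ChartedSpace H G] [Group G] [LieGroup I ∞ G]

/-- `lieExp` chooses a curve separately for each `t • X`. Speeding up one integral curve of `X` by
the factor `t` gives an integral curve of `t • X`, and uniqueness identifies the two at time `1`. -/
theorem isMIntegralCurve_lieExp_smul [CompleteSpace E] [BoundarylessManifold I G]
    (X : GroupLieAlgebra I G) :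
    IsMIntegralCurve (I := I) (fun t : ℝ ↦ lieExp (t • X)) (mulInvariantVectorField X) := by
  have : IsTopologicalGroup G := topologicalGroup_of_lieGroup I ∞
  have : T1Space G := I.t1Space G
  have : T2Space G := inferInstance
  obtain ⟨γ, h0, hγ⟩ := exists_expCurve X
  have key : (fun t : ℝ ↦ lieExp (t • X)) = γ := by
    funext t
    obtain ⟨h0', hδ⟩ := Classical.choose_spec (exists_expCurve (t • X))
    have h := hγ.comp_mul t
    rw [← mulInvariantVectorField_smul] at h
    have := isMIntegralCurve_Ioo_eq_of_contMDiff_boundaryless (t₀ := 0)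
      ((contMDiff_infty_mulInvariantVectorField (t • X)).of_le (by simp)) hδ h (by simp [h0, h0'])
    simpa [lieExp] using congrFun this 1
  rwa [key]

end Curves

/-! ### Linear flows on the dual, and functionals maximal on a ball -/

section LinearAlgebra

open scoped Nat in
/-- The linear flow `p' = p ∘ A` on the dual of a finite-dimensional space. -/
theorem exists_dual_flow {V : Type*} [NormedAddCommGroup V] [NormedSpace ℝ V]
    [FiniteDimensional ℝ V] (A : V →ₗ[ℝ] V) (p₀ : V →ₗ[ℝ] ℝ) :
    ∃ p : ℝ → V →L[ℝ] ℝ,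
      (∀ Y t, HasDerivAt (fun τ ↦ p τ Y) (p t (A Y)) t) ∧
      (p₀ ≠ 0 → ∀ t, p t ≠ 0) ∧
      ∀ q : Submodule ℝ V, (∀ v ∈ q, A v ∈ q) → (∀ v ∈ q, p₀ (A v) = 0) →
        ∀ t, ∀ v ∈ q, p t v = p₀ v := by
  let A' : V →L[ℝ] V := LinearMap.toContinuousLinearMap A
  let P : V →L[ℝ] ℝ := LinearMap.toContinuousLinearMap p₀
  refine ⟨fun t ↦ P ∘L NormedSpace.exp (t • A'), fun Y t ↦ ?_, fun h t ht ↦ ?_,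
    fun q hq h0 t v hv ↦ ?_⟩
  · have h1 := (hasDerivAt_exp_smul_const (𝕂 := ℝ) A' t)
    exact (P ∘L ContinuousLinearMap.apply ℝ V Y).hasFDerivAt.comp_hasDerivAt t h1
  · apply h
    ext v
    have h2 : NormedSpace.exp (t • A') * NormedSpace.exp (-(t • A')) = 1 := by
      let : NormedAlgebra ℚ (V →L[ℝ] V) := NormedAlgebra.restrictScalars ℚ ℝ _
      rw [← NormedSpace.exp_add_of_commute (Commute.refl (t • A')).neg_right, add_neg_cancel,
        NormedSpace.exp_zero]
    have h3 := congrArg (fun L : V →L[ℝ] V ↦ P (L v)) h2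
    have h4 := congrArg (fun L : V →L[ℝ] ℝ ↦ L (NormedSpace.exp (-(t • A')) v)) ht
    exact h3.symm.trans h4
  · have hs := NormedSpace.exp_series_hasSum_exp' (𝕂 := ℝ) (t • A')
    have hs' := (P.hasSum ((ContinuousLinearMap.apply ℝ V v).hasSum hs))
    have hmem : ∀ n : ℕ, ((t • A') ^ n) v ∈ q := by
      intro n
      induction n with
      | zero => simpa using hv
      | succ n ih =>
        rw [pow_succ']
        exact q.smul_mem t (hq _ ih)
    -- Each term of positive degree is a multiple of `p₀ ∘ A` evaluated on an element of `q`, so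
    -- only the constant term of the series survives.
    have hzero : ∀ n : ℕ, n ≠ 0 → P (ContinuousLinearMap.apply ℝ V v
        ((n ! : ℝ)⁻¹ • (t • A') ^ n)) = 0 := by
      intro n hn
      obtain ⟨m, rfl⟩ := Nat.exists_eq_succ_of_ne_zero hn
      have : P (((t • A') ^ (m + 1)) v) = 0 := by
        rw [pow_succ']
        change P (t • A (((t • A') ^ m) v)) = 0
        rw [map_smul]
        exact (congrArg (t • ·) (h0 _ (hmem m))).trans (smul_zero t)
      change P (((m + 1) ! : ℝ)⁻¹ • ((t • A') ^ (m + 1)) v) = 0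
      rw [map_smul, this, smul_zero]
    have := hs'.unique (hasSum_single 0 hzero)
    simpa [P] using this

/-- A linear functional that attains its maximum over the unit ball at a unit vector `x` is a
multiple of the inner product with `x`. -/
theorem eq_mul_inner_of_forall_le {V : Type*} [NormedAddCommGroup V] [InnerProductSpace ℝ V]
    (l : V →ₗ[ℝ] ℝ) {x : V} (hx : ‖x‖ = 1) (hl : ∀ v, ‖v‖ ≤ 1 → l v ≤ l x) (v : V) :
    l v = l x * inner ℝ x v := by
  have hle : ∀ w, l w ≤ l x * ‖w‖ := by
    intro w
    rcases eq_or_ne w 0 with rfl | hw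
    · simp
    have hw' : 0 < ‖w‖ := norm_pos_iff.2 hw
    have h := hl (‖w‖⁻¹ • w) (by rw [norm_smul]; simp [hw'.ne'])
    rw [map_smul, smul_eq_mul, inv_mul_le_iff₀ hw'] at h
    linarith
  have hsq : ∀ w, (l w) ^ 2 ≤ l x ^ 2 * ‖w‖ ^ 2 := by
    intro w
    have h1 := hle w
    have h2 := hle (-w)
    rw [map_neg, norm_neg] at h2
    rw [← mul_pow]
    exact sq_le_sq' (by linarith) h1
  have hlx : 0 ≤ l x := by simpa using hl 0 (by simp)
  -- First-order perturbation: moving from `x` in an orthogonal direction changes the norm only to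
  -- second order, so the linear term must vanish.
  have horth : ∀ w, inner ℝ x w = 0 → l w = 0 := by
    intro w hw
    have hε : ∀ ε : ℝ, 2 * l x * l w * ε + ε ^ 2 * (l w ^ 2 - l x ^ 2 * ‖w‖ ^ 2) ≤ 0 := by
      intro ε
      have h := hsq (x + ε • w)
      rw [norm_add_sq_real, inner_smul_right, hw, norm_smul, mul_pow, hx] at h
      simp only [map_add, map_smul, smul_eq_mul, Real.norm_eq_abs, sq_abs] at h
      nlinarith
    rcases hlx.eq_or_lt with h0 | hpos
    · have := hε 1
      rw [← h0] at this
      nlinarith [sq_nonneg (l w)]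
    · by_contra hne
      set K := l x ^ 2 * ‖w‖ ^ 2 with hK
      have hK0 : 0 ≤ K := by positivity
      -- This `ε` is small enough for the linear gain to outweigh the quadratic loss `ε ^ 2 * K`;
      -- the `+ 1` avoids division by zero.
      have h := hε (l x * l w / (K + 1))
      have hlw : 0 < l w ^ 2 := by positivity
      have h5 : 2 * l x * l w * (l x * l w / (K + 1)) +
          (l x * l w / (K + 1)) ^ 2 * (l w ^ 2 - K) =
          (l x ^ 2 * l w ^ 2) * (K + 2 + l w ^ 2) / (K + 1) ^ 2 := by
        field_simp
        ring
      rw [h5] at h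
      have : 0 < (l x ^ 2 * l w ^ 2) * (K + 2 + l w ^ 2) / (K + 1) ^ 2 := by positivity
      linarith
  have h := horth (v - (inner ℝ x v) • x) (by
    rw [inner_sub_right, inner_smul_right, real_inner_self_eq_norm_sq, hx]; ring)
  rw [map_sub, map_smul, smul_eq_mul] at h
  linarith

/-- The scalar product need not come from the norm of the model space, so the instances it induces
are kept local to the proofs here and below. -/
theorem eq_mul_inner_of_forall_scalarProductNorm_le {V : Type*} [AddCommGroup V] [Module ℝ V]
    (B : InnerProductSpace.Core ℝ V) (l : V →ₗ[ℝ] ℝ) {x : V} (hx : scalarProductNorm B x = 1)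
    (hl : ∀ v, scalarProductNorm B v ≤ 1 → l v ≤ l x) (v : V) :
    l v = l x * B.inner x v := by
  let : NormedAddCommGroup V := B.toNormedAddCommGroup
  let : InnerProductSpace ℝ V := InnerProductSpace.ofCore B.toCore
  exact eq_mul_inner_of_forall_le l hx hl v

theorem inner_le_scalarProductNorm_mul {V : Type*} [AddCommGroup V] [Module ℝ V]
    (B : InnerProductSpace.Core ℝ V) (x v : V) :
    B.inner x v ≤ scalarProductNorm B x * scalarProductNorm B v := by
  let : NormedAddCommGroup V := B.toNormedAddCommGroup
  let : InnerProductSpace ℝ V := InnerProductSpace.ofCore B.toCore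
  exact real_inner_le_norm x v

theorem scalarProductNorm_smul {V : Type*} [AddCommGroup V] [Module ℝ V]
    (B : InnerProductSpace.Core ℝ V) (a : ℝ) (x : V) :
    scalarProductNorm B (a • x) = |a| * scalarProductNorm B x := by
  let : NormedAddCommGroup V := B.toNormedAddCommGroup
  let : InnerProductSpace ℝ V := InnerProductSpace.ofCore B.toCore
  exact norm_smul a x

theorem scalarProductNorm_pos {V : Type*} [AddCommGroup V] [Module ℝ V]
    (B : InnerProductSpace.Core ℝ V) {x : V} (hx : x ≠ 0) : 0 < scalarProductNorm B x := by
  let : NormedAddCommGroup V := B.toNormedAddCommGroup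
  exact norm_pos_iff.2 hx

/-- The scalar product with a fixed vector, as a linear functional. -/
noncomputable def innerLeft {V : Type*} [AddCommGroup V] [Module ℝ V]
    (B : InnerProductSpace.Core ℝ V) (x : V) : V →ₗ[ℝ] ℝ :=
  letI : NormedAddCommGroup V := B.toNormedAddCommGroup
  letI : InnerProductSpace ℝ V := InnerProductSpace.ofCore B.toCore
  innerₗ V x

theorem innerLeft_apply {V : Type*} [AddCommGroup V] [Module ℝ V]
    (B : InnerProductSpace.Core ℝ V) (x v : V) : innerLeft B x v = B.inner x v := rfl

theorem inner_smul_left_core {V : Type*} [AddCommGroup V] [Module ℝ V]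
    (B : InnerProductSpace.Core ℝ V) (a : ℝ) (x v : V) :
    B.inner (a • x) v = a * B.inner x v :=
  B.smul_left x v a

end LinearAlgebra

/-! ### The adjoint equation in a left-invariant frame -/

section Adjoint

open Bundle VectorField

variable {E : Type*} [NormedAddCommGroup E] [NormedSpace ℝ E] [FiniteDimensional ℝ E]
  {H : Type*} [TopologicalSpace H] {I : ModelWithCorners ℝ E H}
  {G : Type*} [TopologicalSpace G] [ChartedSpace H G] [Group G] [LieGroup I ∞ G]

/-- If the adjoint equation holds for left-invariant fields, it holds for all smooth fields. -/
theorem hasDerivAt_covector_of_mulInvariantVectorField {X : GroupLieAlgebra I G} {g : ℝ → G}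
    (hg : IsMIntegralCurve (I := I) g (mulInvariantVectorField X))
    {ψ : (t : ℝ) → TangentSpace I (g t) →L[ℝ] ℝ}
    (hψ : ∀ (Y : GroupLieAlgebra I G) t, HasDerivAt (fun τ ↦ ψ τ (mulInvariantVectorField Y (g τ)))
      (ψ t (mulInvariantVectorField ⁅X, Y⁆ (g t))) t)
    {W : (x : G) → TangentSpace I x}
    (hW : ContMDiff I I.tangent ∞ (fun x ↦ (⟨x, W x⟩ : TangentBundle I G))) (t : ℝ) :
    HasDerivAt (fun τ ↦ ψ τ (W (g τ)))
      (ψ t (mlieBracket I (mulInvariantVectorField X) W (g t))) t := by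
  have : CompleteSpace E := FiniteDimensional.complete ℝ E
  have : FiniteDimensional ℝ (GroupLieAlgebra I G) := inferInstanceAs (FiniteDimensional ℝ E)
  have : IsManifold I 2 G := IsManifold.of_le (n := ∞) ENat.LEInfty.out
  let b := Module.finBasis ℝ (GroupLieAlgebra I G)
  let f : Fin (Module.finrank ℝ (GroupLieAlgebra I G)) → G → ℝ :=
    fun i x ↦ b.coord i (leftTrivialization x (W x))
  have hf : ∀ i, MDifferentiable I 𝓘(ℝ, ℝ) (f i) := by
    intro i
    let c : E →L[ℝ] ℝ := LinearMap.toContinuousLinearMap (show E →ₗ[ℝ] ℝ from b.coord i)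
    exact (c.contMDiff.comp (contMDiff_leftTrivialization hW)).mdifferentiable
      (by simp : (∞ : WithTop ℕ∞) ≠ 0)
  have hWsum : W = ∑ i, f i • mulInvariantVectorField (b i) := by
    funext x
    have h1 := mulInvariantVectorField_leftTrivialization x (W x)
    rw [← b.sum_repr (leftTrivialization x (W x))] at h1
    rw [← h1]
    simp only [Finset.sum_apply]
    refine (map_sum (mfderiv I I (x * ·) (1 : G)) _ _).trans (Finset.sum_congr rfl fun i _ ↦ ?_)
    exact map_smul (mfderiv I I (x * ·) (1 : G)) _ _
  have hsum : ∀ τ, ψ τ (W (g τ)) =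
      ∑ i, f i (g τ) * ψ τ (mulInvariantVectorField (b i) (g τ)) := by
    intro τ
    conv_lhs => rw [hWsum]
    simp only [Finset.sum_apply]
    refine (map_sum (ψ τ) _ _).trans (Finset.sum_congr rfl fun i _ ↦ ?_)
    exact map_smul (ψ τ) _ _
  -- By the Leibniz rule the bracket contributes the derivatives of the coefficients along `X`,
  -- matching the product rule for the sum in `hsum`.
  have hbr : ψ t (mlieBracket I (mulInvariantVectorField X) W (g t)) =
      ∑ i, (mvfderiv I (f i) (g t) (mulInvariantVectorField X (g t)) *
        ψ t (mulInvariantVectorField (b i) (g t)) +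
        f i (g t) * ψ t (mulInvariantVectorField ⁅X, b i⁆ (g t))) := by
    conv_lhs => rw [hWsum]
    rw [mlieBracket_finset_sum_smul _ _ _ _ _ hf fun i ↦
      (contMDiff_infty_mulInvariantVectorField (b i)).mdifferentiable (by simp), map_sum]
    refine Finset.sum_congr rfl fun i _ ↦ ?_
    rw [map_add, map_smul, map_smul, GroupLieAlgebra.bracket_def, mulInvariantVector_mlieBracket]
    rfl
  simp only [hsum]
  rw [hbr]
  refine HasDerivAt.fun_sum fun i _ ↦ ?_
  exact ((hg t).hasDerivAt_comp_curve (hf i _)).mul (hψ (b i) t)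

end Adjoint

/-! ### The maximum principle along a one-parameter subgroup -/

section Extremals

open Bundle VectorField

variable {E : Type*} [NormedAddCommGroup E] [NormedSpace ℝ E] [FiniteDimensional ℝ E]
  {H : Type*} [TopologicalSpace H] {I : ModelWithCorners ℝ E H}
  {G : Type*} [TopologicalSpace G] [ChartedSpace H G] [Group G] [LieGroup I ∞ G]

/-- A covector that annihilates `[X, q]` and is maximal at `X ∈ q` over the unit ball extends along
a one-parameter subgroup with direction `X ∈ q` normalizing `q` to a solution of the maximum
principle. -/
theorem exists_satisfiesPMP_of_dual {q : Submodule ℝ (GroupLieAlgebra I G)} {F : q → ℝ} {X : q}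
    (hX : F X = 1) {g : ℝ → G}
    (hg : IsMIntegralCurve (I := I) g (mulInvariantVectorField (X : GroupLieAlgebra I G)))
    (p₀ : GroupLieAlgebra I G →ₗ[ℝ] ℝ) (hp₀ : p₀ ≠ 0)
    (hq : ∀ v : q, ⁅(X : GroupLieAlgebra I G), (v : GroupLieAlgebra I G)⁆ ∈ q)
    (h0 : ∀ v : q, p₀ ⁅(X : GroupLieAlgebra I G), (v : GroupLieAlgebra I G)⁆ = 0)
    (hM : 0 ≤ p₀ X) (hmax : ∀ v : q, F v ≤ 1 → p₀ v ≤ p₀ X) :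
    ∃ ψ : (t : ℝ) → TangentSpace I (g t) →L[ℝ] ℝ, SatisfiesPMP q F g (fun _ ↦ X) ψ (p₀ X) := by
  have : CompleteSpace E := FiniteDimensional.complete ℝ E
  obtain ⟨p, hp, hpne, hpq⟩ := exists_dual_flow (V := E)
    (show E →ₗ[ℝ] E from LieAlgebra.ad ℝ (GroupLieAlgebra I G) (X : GroupLieAlgebra I G)) p₀
  let ψ : (t : ℝ) → TangentSpace I (g t) →L[ℝ] ℝ := fun t ↦
    (show GroupLieAlgebra I G →L[ℝ] ℝ from p t).comp (leftTrivialization (g t))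
  have hψ : ∀ t (Y : GroupLieAlgebra I G), ψ t (mulInvariantVectorField Y (g t)) = p t Y :=
    fun t Y ↦ congrArg (p t) (leftTrivialization_mulInvariantVectorField (g t) Y)
  -- On `q` the covector does not move, so maximality of `p₀` passes to all times.
  have hψq : ∀ t (v : q), ψ t (mulInvariantVectorField (v : GroupLieAlgebra I G) (g t)) = p₀ v :=
    fun t v ↦ (hψ t v).trans
      (hpq q (fun v hv ↦ hq ⟨v, hv⟩) (fun v hv ↦ h0 ⟨v, hv⟩) t (v : GroupLieAlgebra I G) v.2)
  have hadj : ∀ W : (x : G) → TangentSpace I x,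
      ContMDiff I I.tangent ∞ (fun x ↦ (⟨x, W x⟩ : TangentBundle I G)) →
      ∀ t, HasDerivAt (fun τ ↦ ψ τ (W (g τ)))
        (ψ t (mlieBracket I (mulInvariantVectorField (X : GroupLieAlgebra I G)) W (g t))) t := by
    intro W hW t
    refine hasDerivAt_covector_of_mulInvariantVectorField hg (fun Y t ↦ ?_) hW t
    simp only [hψ]
    exact hp Y t
  have hXsmooth := contMDiff_infty_mulInvariantVectorField (X : GroupLieAlgebra I G)
  refine ⟨ψ, ?_⟩
  exact
    { continuous_curve := hg.continuous
      absolutelyContinuous_curve := fun f hf a b ↦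
        have : IsManifold I 1 G := IsManifold.of_le (n := ∞) ENat.LEInfty.out
        hg.absolutelyContinuousOnInterval_comp hXsmooth.continuous
          (hf.of_le ENat.LEInfty.out) a b
      measurable_control := fun l ↦ measurable_const
      control_mem := fun _ ↦ hX.le
      arclength := .of_forall fun _ ↦ hX
      deriv_curve := .of_forall hg
      ne_zero := by
        intro t ht
        refine hpne (fun h ↦ hp₀ h) t (ContinuousLinearMap.ext fun Y ↦ ?_)
        rw [← hψ t Y, ht]
        rfl
      absolutelyContinuous_covector := by
        intro W hW a b
        refine absolutelyContinuousOnInterval_of_hasDerivAt (hadj W hW) ?_ a b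
        have : IsManifold I (((⊤ : ℕ∞) : WithTop ℕ∞) + 1) G := inferInstanceAs (IsManifold I ∞ G)
        -- The derivative of `ψ (W ∘ g)` pairs `ψ` with another smooth field, so `hadj` applied to
        -- that field shows it is continuous.
        have hbr : ContMDiff I I.tangent ∞ (fun x ↦ (⟨x, mlieBracket I
            (mulInvariantVectorField (X : GroupLieAlgebra I G)) W x⟩ : TangentBundle I G)) :=
          _root_.ContDiff.mlieBracket_vectorField (m := ⊤) (n := ⊤) hXsmooth hW (by simp)
        exact continuous_iff_continuousAt.2 fun t ↦ (hadj _ hbr t).continuousAt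
      adjoint := fun W hW ↦ .of_forall (hadj W hW)
      maximum := .of_forall fun t v hv ↦ by
        rw [hψq, hψq]
        exact hmax v hv
      maximum_eq := .of_forall fun t ↦ hψq t X
      maximum_nonneg := hM }

/-- A covector that is maximal at `X` is determined on `q` by `X` and `M`, so its pairing with a
left-invariant field from `q` is constant in time. The adjoint equation computes the zero derivative
as `M (X, [X, v])`. -/
theorem SatisfiesPMP.inner_lie_eq_zero {q : Submodule ℝ (GroupLieAlgebra I G)}
    {B : InnerProductSpace.Core ℝ q} {X : q} {g : ℝ → G}
    (hg : IsMIntegralCurve (I := I) g (mulInvariantVectorField (X : GroupLieAlgebra I G)))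
    {u : ℝ → q} {ψ : (t : ℝ) → TangentSpace I (g t) →L[ℝ] ℝ} {M : ℝ} (hM : 0 < M)
    (h : SatisfiesPMP q (scalarProductNorm B) g u ψ M) (v : q)
    (hv : ⁅(X : GroupLieAlgebra I G), (v : GroupLieAlgebra I G)⁆ ∈ q) :
    B.inner X ⟨_, hv⟩ = 0 := by
  have : CompleteSpace E := FiniteDimensional.complete ℝ E
  -- The control is not prescribed, but the velocity of `g` determines it almost everywhere.
  have hu : ∀ᵐ t, u t = X := by
    filter_upwards [h.deriv_curve] with t ht
    have h1 := DFunLike.congr_fun (hasMFDerivAt_unique ht (hg t)) (1 : ℝ)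
    have h2 : mulInvariantVectorField (u t : GroupLieAlgebra I G) (g t) =
        mulInvariantVectorField (X : GroupLieAlgebra I G) (g t) :=
      ((one_smul ℝ _).symm.trans h1).trans (one_smul ℝ _)
    have h3 := congrArg (leftTrivialization (g t)) h2
    rw [leftTrivialization_mulInvariantVectorField,
      leftTrivialization_mulInvariantVectorField] at h3
    exact Subtype.ext h3
  have hae : ∀ᵐ t, ∀ w : q,
      ψ t (mulInvariantVectorField (w : GroupLieAlgebra I G) (g t)) = M * B.inner X w := by
    filter_upwards [hu, h.arclength, h.maximum, h.maximum_eq] with t htu ht1 htm hte w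
    rw [htu] at ht1 htm hte
    let l : q →ₗ[ℝ] ℝ :=
      ((ψ t).toLinearMap ∘ₗ (mfderiv I I (g t * ·) (1 : G)).toLinearMap) ∘ₗ q.subtype
    have := eq_mul_inner_of_forall_scalarProductNorm_le B l ht1 htm w
    have hlX : l X = M := hte
    rw [hlX] at this
    exact this
  -- Continuity upgrades the identity from almost every time to every time, which is needed to
  -- differentiate it.
  have hall : ∀ (w : q) t,
      ψ t (mulInvariantVectorField (w : GroupLieAlgebra I G) (g t)) = M * B.inner X w := by
    intro w
    have hcont : Continuous
        (fun t ↦ ψ t (mulInvariantVectorField (w : GroupLieAlgebra I G) (g t))) := by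
      refine continuous_iff_continuousAt.2 fun t ↦ ?_
      have hac := h.absolutelyContinuous_covector _
        (contMDiff_infty_mulInvariantVectorField (w : GroupLieAlgebra I G)) (t - 1) (t + 1)
      refine hac.continuousOn.continuousAt ?_
      rw [Set.uIcc_of_le (by linarith)]
      exact Icc_mem_nhds (by linarith) (by linarith)
    have := (hcont.ae_eq_iff_eq (μ := MeasureTheory.volume)
      (continuous_const (y := M * B.inner X w))).1 (hae.mono fun t ht ↦ ht w)
    exact fun t ↦ congrFun this t
  obtain ⟨t, htu, hadj⟩ := (hu.and (h.adjoint _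
    (contMDiff_infty_mulInvariantVectorField (v : GroupLieAlgebra I G)))).exists
  simp only [hall] at hadj
  have h0 := hadj.unique (hasDerivAt_const t _)
  rw [htu, ← mulInvariantVector_mlieBracket, ← GroupLieAlgebra.bracket_def] at h0
  have h1 := (hall ⟨_, hv⟩ t).symm.trans h0
  exact (mul_eq_zero.1 h1).resolve_left hM.ne'

end Extremals

/-! ### Orthogonality in `q` and the main theorem -/

/-- In an orthonormal basis of a three-dimensional subspace, the orthogonal complement of the second
vector is spanned by the other two. -/
theorem mem_span_pair_iff_inner_eq_zero {V : Type*} [AddCommGroup V] [Module ℝ V]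
    {q : Submodule ℝ V} (B : InnerProductSpace.Core ℝ q) (e : Module.Basis (Fin 3) ℝ q)
    (horth : ∀ i j, B.inner (e i) (e j) = if i = j then 1 else 0) (w : q) :
    (w : V) ∈ Submodule.span ℝ {(e 0 : V), (e 2 : V)} ↔ B.inner (e 1) w = 0 := by
  have hl : ∀ v, B.inner (e 1) v = innerLeft B (e 1) v := fun _ ↦ rfl
  rw [Submodule.mem_span_pair]
  constructor
  · rintro ⟨a, b, hab⟩
    have : w = a • e 0 + b • e 2 := Subtype.ext hab.symm
    rw [hl, this, map_add, map_smul, map_smul, ← hl, ← hl, horth, horth]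
    simp
  · intro hw
    have hsum := e.sum_repr w
    rw [Fin.sum_univ_three] at hsum
    have h1 : e.repr w 1 = 0 := by
      rw [hl, ← hsum, map_add, map_add, map_smul, map_smul, map_smul, ← hl, ← hl, ← hl, horth, horth,
        horth] at hw
      simpa using hw
    rw [h1, zero_smul, add_zero] at hsum
    exact ⟨e.repr w 0, e.repr w 2, congrArg Subtype.val hsum⟩

theorem theorem3
    {G : Type*} [TopologicalSpace G] [ChartedSpace (EuclideanSpace ℝ (Fin 4)) G] [Group G]
    [LieGroup (𝓡 4) ∞ G] [ConnectedSpace G]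
    -- a three-dimensional subspace generating the Lie algebra, with a scalar product on it
    (q : Submodule ℝ (GroupLieAlgebra (𝓡 4) G))
    (hdim : Module.finrank ℝ q = 3)
    (hgen : LieSubalgebra.lieSpan ℝ (GroupLieAlgebra (𝓡 4) G)
      (q : Set (GroupLieAlgebra (𝓡 4) G)) = ⊤)
    (B : InnerProductSpace.Core ℝ q)
    -- a nonzero vector of the intersection of `q` with its normalizer
    (e₂ : q) (he₂ : e₂ ≠ 0)
    (hnorm : ∀ x : q, ⁅(e₂ : GroupLieAlgebra (𝓡 4) G), (x : GroupLieAlgebra (𝓡 4) G)⁆ ∈ q)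
    -- an orthonormal basis of `q` whose second vector is parallel to `e₂`
    (e' : Module.Basis (Fin 3) ℝ q)
    (horth : ∀ i j, B.inner (e' i) (e' j) = if i = j then 1 else 0)
    (hpar : ∃ c : ℝ, e' 1 = c • e₂)
    (s : ℝ) (hs : s = 1 ∨ s = -1)
    (g : ℝ → G)
    (hg : ∀ t, g t = lieExp ((s * t / scalarProductNorm B (s • e₂)) •
      (e₂ : GroupLieAlgebra (𝓡 4) G))) :
    IsAbnormalExtremal q (scalarProductNorm B) g ∧
    (IsNonstronglyAbnormal q (scalarProductNorm B) g ↔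
      ∀ x : q, ⁅(e₂ : GroupLieAlgebra (𝓡 4) G), (x : GroupLieAlgebra (𝓡 4) G)⁆ ∈
        Submodule.span ℝ
          {(e' 0 : GroupLieAlgebra (𝓡 4) G), (e' 2 : GroupLieAlgebra (𝓡 4) G)}) := by
  have hfin4 : Module.finrank ℝ (GroupLieAlgebra (𝓡 4) G) = 4 :=
    finrank_euclideanSpace_fin (𝕜 := ℝ) (n := 4)
  have hs0 : s ≠ 0 := by rcases hs with rfl | rfl <;> norm_num
  have hN : 0 < scalarProductNorm B (s • e₂) := scalarProductNorm_pos B (smul_ne_zero hs0 he₂)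
  set N := scalarProductNorm B (s • e₂) with hNdef
  have hsN : s / N ≠ 0 := div_ne_zero hs0 hN.ne'
  obtain ⟨c, hc⟩ := hpar
  have hc0 : c ≠ 0 := by
    rintro rfl
    exact e'.ne_zero 1 (by rw [hc, zero_smul])
  let X : q := (s / N) • e₂
  have hX : scalarProductNorm B X = 1 := by
    have : X = N⁻¹ • s • e₂ := by rw [smul_smul, mul_comm, ← div_eq_mul_inv]
    rw [this, scalarProductNorm_smul, ← hNdef, abs_of_pos (inv_pos.2 hN), inv_mul_cancel₀ hN.ne']
  have hXe : X = (s / N * c⁻¹) • e' 1 := by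
    rw [hc, smul_smul, mul_assoc, inv_mul_cancel₀ hc0, mul_one]
  have hXlie : ∀ v : q, ⁅(X : GroupLieAlgebra (𝓡 4) G), (v : GroupLieAlgebra (𝓡 4) G)⁆ =
      (s / N) • ⁅(e₂ : GroupLieAlgebra (𝓡 4) G), (v : GroupLieAlgebra (𝓡 4) G)⁆ :=
    fun v ↦ smul_lie _ _ _
  have hXq : ∀ v : q, ⁅(X : GroupLieAlgebra (𝓡 4) G), (v : GroupLieAlgebra (𝓡 4) G)⁆ ∈ q := by
    intro v
    rw [hXlie]
    exact q.smul_mem _ (hnorm v)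
  have hgX : IsMIntegralCurve (I := 𝓡 4) g
      (mulInvariantVectorField (X : GroupLieAlgebra (𝓡 4) G)) := by
    have hgX' : g = fun t : ℝ ↦ lieExp (t • (X : GroupLieAlgebra (𝓡 4) G)) := by
      funext t
      rw [hg t, Submodule.coe_smul, smul_smul]
      congr 2
      ring
    rw [hgX']
    exact isMIntegralCurve_lieExp_smul _
  have hspan : ∀ x : q, ⁅(e₂ : GroupLieAlgebra (𝓡 4) G), (x : GroupLieAlgebra (𝓡 4) G)⁆ ∈
      Submodule.span ℝ {(e' 0 : GroupLieAlgebra (𝓡 4) G), (e' 2 : GroupLieAlgebra (𝓡 4) G)} ↔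
      B.inner X ⟨_, hXq x⟩ = 0 := by
    intro x
    -- `X` and `[X, x]` are nonzero scalar multiples of `e' 1` and `[e₂, x]`, and the scalars do not
    -- affect orthogonality.
    have hcoe : (⟨_, hXq x⟩ : q) = (s / N) • (⟨_, hnorm x⟩ : q) := Subtype.ext (hXlie x)
    have h1 := mem_span_pair_iff_inner_eq_zero B e' horth ⟨_, hnorm x⟩
    rw [h1, hcoe, ← innerLeft_apply B X, map_smul, innerLeft_apply, hXe, inner_smul_left_core]
    simp [hsN, hc0]
  have habn : IsAbnormalExtremal q (scalarProductNorm B) g := by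
    have hqtop : q < ⊤ := by
      refine lt_top_iff_ne_top.2 fun h ↦ ?_
      rw [h, finrank_top, hfin4] at hdim
      omega
    -- As `3 < 4`, some nonzero functional kills `q`; the maximum condition becomes `0 ≤ 0`.
    obtain ⟨p₀, hp₀, hp₀q⟩ := q.exists_le_ker_of_lt_top hqtop
    have hz : ∀ v : q, p₀ v = 0 := fun v ↦ hp₀q v.2
    obtain ⟨ψ, hψ⟩ := exists_satisfiesPMP_of_dual hX hgX p₀ hp₀ hXq
      (fun v ↦ hp₀q (hXq v)) (hz X).ge (fun v _ ↦ by rw [hz, hz])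
    rw [hz X] at hψ
    exact ⟨_, ψ, hψ⟩
  refine ⟨habn, fun h x ↦ ?_, fun h ↦ ⟨habn, ?_⟩⟩
  · obtain ⟨-, u, ψ, M, hM, hψ⟩ := h
    exact (hspan x).2 (hψ.inner_lie_eq_zero hgX hM x (hXq x))
  -- Any extension of `(X, ·)` to the whole Lie algebra works; its maximum is `M = (X, X) = 1`.
  · obtain ⟨p₀, hp₀⟩ := LinearMap.exists_extend (innerLeft B X)
    have hp : ∀ v : q, p₀ v = B.inner X v := fun v ↦ DFunLike.congr_fun hp₀ v
    have hpX : p₀ X = 1 := by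
      rw [hp]
      exact (Real.sqrt_eq_one).1 hX
    obtain ⟨ψ, hψ⟩ := exists_satisfiesPMP_of_dual hX hgX p₀
      (by rintro rfl; simp at hpX) hXq (fun v ↦ (hp ⟨_, hXq v⟩).trans ((hspan v).1 (h v)))
      (by rw [hpX]; norm_num) (fun v hv ↦ by
        rw [hpX, hp]
        refine (inner_le_scalarProductNorm_mul B X v).trans ?_
        rwa [hX, one_mul])
    exact ⟨_, ψ, _, by rw [hpX]; norm_num, hψ⟩
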